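/- A ribbon graph is a surface with boundary decomposed into finitely many vertex discs and edge discs, where vertex and edge discs meet in disjoint segments, each segment lies on the boundary of exactly one vertex disc and one edge disc, and each edge disc contains exactly two of them (its ends). If a ribbon graph $R$ has $v(R)$ vertices, $e(R)$ edges, $f(R)$ boundary components and $c(R)$ connected components, its Euler genus is $\varepsilon(R)=2c(R)-v(R)+e(R)-f(R)$. For $A\subseteq E(R)$, the partial Petrial $R^{\times|A}$ is obtained from $R$ by adding a half-twist to each edge in $A$. A bouquet is a ribbon graph with exactly one vertex. The intersection graph $I(B)$ of a bouquet $B$ has vertex set $E(B)$, two distinct edges being adjacent if and only if their ends are met in alternating order when travelling round the boundary of the vertex. A circle graph is a graph $G$ isomorphic to $I(B)$ for some bouquet $B$, and its partial Petrial polynomial is $$P_G^{\times}(z)=\sum_{A\subseteq E(B)} z^{\varepsilon(B^{\times|A})}.$$ Theorem. Let $G$ be a (finite, non-empty) connected circle graph. Then $P_G^{\times}(z)$ does not depend on the choice of the bouquet $B$ with $I(B)\cong G$, and $P_G^{\times}(z)$ is binomial (has exactly two non-zero terms) if and only if $G$ is a path, that is, $G$ is isomorphic to the path $P_n$ on $n$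 vertices for some $n\ge 1$. -/

import Mathlib

open Polynomial

universe u

/-- A (finite) ribbon graph, up to homeomorphism preserving the decomposition into discs.

Each edge disc `e` is a rectangle glued to vertex discs along two opposite sides, its two *ends*
`(e, false)` and `(e, true)`. Each end is a segment with two endpoints, so each edge has four
*corners* `(e, b, s)`: the endpoint with label `s` of the end `(e, b)`.

What remains of the boundaries of the vertex discs after removal of the ends is a family of arcs
(together with full circles, one for each vertex disc that meets no edge). `arc` sends a corner to
the other endpoint of the arc that begins there. The two free sides of the edge disc `e` join
`(e, false, s)` to `(e, true, s)` if `twist e = false`, and `(e, false, s)` to `(e, true, !s)` if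
`twist e = true`. -/
structure RibbonGraph : Type (u + 1) where
  /-- the set of edges -/
  E : Type u
  /-- there are finitely many edges -/
  [fintypeE : Fintype E]
  /-- the arcs of the vertex boundaries between consecutive ends -/
  arc : E × Bool × Bool → E × Bool × Bool
  arc_arc : ∀ x, arc (arc x) = x
  arc_ne : ∀ x, arc x ≠ x
  /-- how the free sides of each edge disc join its corners -/
  twist : E → Bool
  /-- the number of vertex discs that meet no edge -/
  isolated : ℕ

namespace RibbonGraph

attribute [instance] RibbonGraph.fintypeE

/-- The corners of the edge discs. -/
abbrev Corner (R : RibbonGraph.{u}) : Type u := R.E × Bool × Bool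

/-- The other endpoint of the end at which a corner lies. -/
def across (R : RibbonGraph.{u}) (x : R.Corner) : R.Corner := (x.1, x.2.1, !x.2.2)

/-- The other endpoint of the free side of the edge disc that begins at a corner. -/
def along (R : RibbonGraph.{u}) (x : R.Corner) : R.Corner :=
  (x.1, !x.2.1, xor (R.twist x.1) x.2.2)

/-- The number of vertices. The boundary of a vertex disc that meets an edge is a closed curve made
of ends and arcs. -/
noncomputable def numVertices (R : RibbonGraph.{u}) : ℕ :=
  Nat.card (Quot fun x y : R.Corner => y = R.across x ∨ y = R.arc x) + R.isolated

/-- The number of edges. -/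
def numEdges (R : RibbonGraph.{u}) : ℕ := Fintype.card R.E

/-- The number of boundary components of the surface. A boundary component is a closed curve made of
free sides of edge discs and arcs, or the boundary of an isolated vertex disc. -/
noncomputable def numBoundary (R : RibbonGraph.{u}) : ℕ :=
  Nat.card (Quot fun x y : R.Corner => y = R.along x ∨ y = R.arc x) + R.isolated

/-- The number of connected components. -/
noncomputable def numComponents (R : RibbonGraph.{u}) : ℕ :=
  Nat.card (Quot fun x y : R.Corner => y = R.across x ∨ y = R.along x ∨ y = R.arc x) + R.isolated

/-- The Euler characteristic `v - e + f`. -/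
noncomputable def eulerChar (R : RibbonGraph.{u}) : ℤ :=
  (R.numVertices : ℤ) - R.numEdges + R.numBoundary

/-- The Euler genus `2c - χ`. -/
noncomputable def eulerGenus (R : RibbonGraph.{u}) : ℤ := 2 * (R.numComponents : ℤ) - R.eulerChar

open Classical in
/-- The partial Petrial: add a half-twist to each edge in `A`. -/
noncomputable def partialPetrial (R : RibbonGraph.{u}) (A : Finset R.E) : RibbonGraph.{u} where
  E := R.E
  arc := R.arc
  arc_arc := R.arc_arc
  arc_ne := R.arc_ne
  twist e := if e ∈ A then !(R.twist e) else R.twist e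
  isolated := R.isolated

/-- The partial Petrial polynomial of a ribbon graph, the sum of `z ^ ε` over all partial Petrials.
(The Euler genus of a ribbon graph is never negative, so `toNat` only changes the type.) -/
noncomputable def petrialPolynomial (R : RibbonGraph.{u}) : ℤ[X] :=
  ∑ A : Finset R.E, X ^ (R.partialPetrial A).eulerGenus.toNat

/-- A bouquet is a ribbon graph with exactly one vertex. -/
def IsBouquet (R : RibbonGraph.{u}) : Prop := R.numVertices = 1

/-- Travelling round a vertex boundary: from a corner, cross the end to which it belongs and follow
the next arc to the first corner of the next end. Iterating this from a corner `x`, each end on the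
vertex boundary is met exactly once in every `Function.minimalPeriod R.travel x` steps. -/
def travel (R : RibbonGraph.{u}) (x : R.Corner) : R.Corner := R.arc (R.across x)

/-- The edges `e₁`, `e₂` are interlaced: in one round along a vertex boundary, starting from an end
of `e₁`, one meets ends of `e₁`, `e₂`, `e₁`, `e₂` in this order. -/
def Interlaced (R : RibbonGraph.{u}) (e₁ e₂ : R.E) : Prop :=
  e₁ ≠ e₂ ∧ ∃ (x : R.Corner) (i j k : ℕ),
    0 < i ∧ i < j ∧ j < k ∧ k < Function.minimalPeriod R.travel x ∧
    x.1 = e₁ ∧ (R.travel^[i] x).1 = e₂ ∧ (R.travel^[j] x).1 = e₁ ∧ (R.travel^[k] x).1 = e₂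

theorem Interlaced.symm {R : RibbonGraph.{u}} {e₁ e₂ : R.E} (h : R.Interlaced e₁ e₂) :
    R.Interlaced e₂ e₁ := by
  obtain ⟨hne, x, i, j, k, hi, hij, hjk, hk, h0, h1, h2, h3⟩ := h
  have hx : x ∈ Function.periodicPts R.travel :=
    Function.minimalPeriod_pos_iff_mem_periodicPts.mp (by omega)
  refine ⟨hne.symm, R.travel^[i] x, j - i, k - i, Function.minimalPeriod R.travel x - i,
    by omega, by omega, by omega, ?_, h1, ?_, ?_, ?_⟩
  · rw [Function.minimalPeriod_apply_iterate hx]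
    omega
  · rw [← Function.iterate_add_apply, Nat.sub_add_cancel (by omega)]
    exact h2
  · rw [← Function.iterate_add_apply, Nat.sub_add_cancel (by omega)]
    exact h3
  · rw [← Function.iterate_add_apply, Nat.sub_add_cancel (by omega),
      Function.iterate_minimalPeriod]
    exact h0

/-- The intersection graph of a bouquet: its vertices are the edges of the bouquet, and adjacency is
being interlaced. -/
def intersectionGraph (R : RibbonGraph.{u}) : SimpleGraph R.E where
  Adj e₁ e₂ := R.Interlaced e₁ e₂
  symm := ⟨fun _ _ h => h.symm⟩
  loopless := ⟨fun _ h => h.1 rfl⟩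

end RibbonGraph

/-- A circle graph is a graph isomorphic to the intersection graph of a bouquet. -/
def IsCircleGraph {V : Type u} (G : SimpleGraph V) : Prop :=
  ∃ B : RibbonGraph.{u}, B.IsBouquet ∧ Nonempty (B.intersectionGraph ≃g G)

/-- The partial Petrial polynomial of a circle graph `G`: that of a bouquet whose intersection graph
is isomorphic to `G`. -/
noncomputable def circleGraphPetrialPolynomial {V : Type u} (G : SimpleGraph V)
    (hG : IsCircleGraph G) : ℤ[X] :=
  hG.choose.petrialPolynomial

/-- A polynomial is binomial if it has exactly two non-zero terms. -/
def IsBinomial (P : ℤ[X]) : Prop := P.support.card = 2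

/-- A graph is a path if it is isomorphic to the path on `n` vertices for some `n`. -/
def IsPathGraph {V : Type u} (G : SimpleGraph V) : Prop :=
  ∃ n : ℕ, Nonempty (G ≃g SimpleGraph.pathGraph n)

/-! Let `A` be the adjacency matrix over `ZMod 2` of the intersection graph of a bouquet. A `ZMod
2`-valued function on the boundary components is a function on the corners, constant along arcs and
free sides. Its jumps `y e` across the ends of the edges determine it up to a constant, and a vector
`y` arises in this way exactly when `(A + D) y = 0`, where the diagonal `D` marks the edges that
form a Möbius band with the vertex. Hence `f = dim ker (A + D) + 1`, and the Euler genus is the rank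
of `A + D` (`IsBouquet.numBoundary_eq`, `IsBouquet.eulerGenus_eq`). The partial Petrials run through
every `D` once, so the polynomial is a generating function of ranks that depends on the graph alone
(`IsBouquet.petrialPolynomial_eq`).

Some `D` makes the all-ones vector null, and a positive nullity can be lowered by exactly one by
changing one diagonal entry. The nullities thus fill an interval from 0 to some `m ≥ 1`, and the
polynomial is binomial iff `m = 1` (`isBinomial_rankPolynomial_iff`).

On a path, a null vector is determined by its value at an end, so `m = 1`. Conversely, pivoting on a
diagonal entry 1 passes the bound `m ≤ 1` to a local complement with the vertex deleted
(`TwoNull.of_localDelete`), which by induction is a path. If this holds at every vertex, the graph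
has a leaf (`exists_leaf_of_localDelete`). The leaf must hang from an end of the remaining path,
since otherwise the two sides of its neighbour carry independent null vectors
(`twoNull_of_leaf_of_cut`). -/

/-! ### Nullities of a symmetric matrix over `ZMod 2` with free diagonal -/

section NullVectors

variable {V : Type u} [Fintype V]

open Classical in
/-- The sum over `ZMod 2` of a function over the neighbours of a vertex. -/
noncomputable def nbrSum (G : SimpleGraph V) (x : V → ZMod 2) (v : V) : ZMod 2 :=
  ∑ u, if G.Adj v u then x u else 0

theorem nbrSum_add (G : SimpleGraph V) (x y : V → ZMod 2) (v : V) :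
    nbrSum G (x + y) v = nbrSum G x v + nbrSum G y v := by
  simp only [nbrSum, ← Finset.sum_add_distrib, Pi.add_apply]
  exact Finset.sum_congr rfl fun u _ => by split_ifs <;> simp

/-- The adjacency matrix of a graph over `ZMod 2` plus a diagonal matrix, as a linear map. -/
noncomputable def shiftedAdj (G : SimpleGraph V) (d : V → ZMod 2) :
    (V → ZMod 2) →ₗ[ZMod 2] (V → ZMod 2) where
  toFun x v := nbrSum G x v + d v * x v
  map_add' x y := by
    funext v
    simp only [Pi.add_apply, nbrSum_add]
    ring
  map_smul' c x := by
    funext v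
    simp only [nbrSum, Pi.smul_apply, smul_eq_mul, RingHom.id_apply, mul_add, Finset.mul_sum,
      mul_ite, mul_zero]
    ring

/-- The vector `x` is in the kernel of the adjacency matrix with diagonal `d`. -/
def IsNull (G : SimpleGraph V) (d x : V → ZMod 2) : Prop := ∀ v, nbrSum G x v = d v * x v

theorem mem_ker_shiftedAdj {G : SimpleGraph V} {d x : V → ZMod 2} :
    x ∈ LinearMap.ker (shiftedAdj G d) ↔ IsNull G d x := by
  rw [LinearMap.mem_ker, funext_iff]
  exact forall_congr' fun v => CharTwo.add_eq_zero

/-- For some choice of the diagonal, the adjacency matrix over `ZMod 2` has nullity at least two. -/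
def TwoNull (G : SimpleGraph V) : Prop :=
  ∃ d x y : V → ZMod 2, x ≠ 0 ∧ y ≠ 0 ∧ x ≠ y ∧ IsNull G d x ∧ IsNull G d y

theorem zmod_two_cases (a : ZMod 2) : a = 0 ∨ a = 1 := by
  revert a; decide

/-- A line over `ZMod 2` has only one nonzero vector, so two distinct nonzero vectors already force
dimension two. -/
theorem two_le_finrank_ker_iff {G : SimpleGraph V} {d : V → ZMod 2} :
    2 ≤ Module.finrank (ZMod 2) (LinearMap.ker (shiftedAdj G d)) ↔
      ∃ x y : V → ZMod 2, x ≠ 0 ∧ y ≠ 0 ∧ x ≠ y ∧ IsNull G d x ∧ IsNull G d y := by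
  constructor
  · intro h
    by_contra! hc
    have hnt : Nontrivial (LinearMap.ker (shiftedAdj G d)) :=
      Module.nontrivial_of_finrank_pos (R := ZMod 2) (by omega)
    obtain ⟨x, hx⟩ := exists_ne (0 : LinearMap.ker (shiftedAdj G d))
    have : Module.finrank (ZMod 2) (LinearMap.ker (shiftedAdj G d)) ≤ 1 := by
      refine finrank_le_one x fun y => ?_
      by_cases hy : y = 0
      · exact ⟨0, by simp [hy]⟩
      · refine ⟨1, ?_⟩
        by_contra hne
        rw [one_smul] at hne
        exact hc x.1 y.1 (fun h0 => hx (Subtype.ext h0)) (fun h0 => hy (Subtype.ext h0))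
          (fun h0 => hne (Subtype.ext h0)) (mem_ker_shiftedAdj.1 x.2) (mem_ker_shiftedAdj.1 y.2)
    omega
  · rintro ⟨x, y, hx, hy, hxy, hnx, hny⟩
    by_contra hlt
    obtain ⟨v, hv⟩ := finrank_le_one_iff.1 (show Module.finrank (ZMod 2)
      (LinearMap.ker (shiftedAdj G d)) ≤ 1 by omega)
    have key : ∀ z : V → ZMod 2, z ≠ 0 → IsNull G d z → z = v.1 := by
      intro z hz hnz
      obtain ⟨c, hc⟩ := hv ⟨z, mem_ker_shiftedAdj.2 hnz⟩
      have hc' : c • v.1 = z := congrArg Subtype.val hc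
      rcases zmod_two_cases c with rfl | rfl
      · exact absurd (by simpa using hc'.symm) hz
      · simpa using hc'.symm
    exact hxy ((key x hx hnx).trans (key y hy hny).symm)

theorem twoNull_iff {G : SimpleGraph V} :
    TwoNull G ↔ ∃ d, 2 ≤ Module.finrank (ZMod 2) (LinearMap.ker (shiftedAdj G d)) := by
  simp only [two_le_finrank_ker_iff, TwoNull]

/-- A null vector pairs to zero with everything in the range of a symmetric matrix. -/
theorem IsNull.sum_mul_shiftedAdj {G : SimpleGraph V} {d x : V → ZMod 2} (hx : IsNull G d x)
    (z : V → ZMod 2) : ∑ v, x v * shiftedAdj G d z v = 0 := by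
  have h1 : ∑ v, x v * nbrSum G z v = ∑ v, nbrSum G x v * z v := by
    simp only [nbrSum, Finset.mul_sum, Finset.sum_mul]
    rw [Finset.sum_comm]
    refine Finset.sum_congr rfl fun u _ => Finset.sum_congr rfl fun v _ => ?_
    by_cases h : G.Adj u v
    · simp [h, h.symm]
    · have h' : ¬ G.Adj v u := fun h' => h h'.symm
      simp [h, h']
  have h2 : ∀ v, x v * shiftedAdj G d z v = x v * nbrSum G z v + d v * x v * z v := by
    intro v
    simp only [shiftedAdj, LinearMap.coe_mk, AddHom.coe_mk]
    ring
  have h3 : ∑ v, nbrSum G x v * z v = ∑ v, d v * x v * z v :=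
    Finset.sum_congr rfl fun v _ => by rw [hx v]
  simp only [h2, Finset.sum_add_distrib, h1, h3]
  exact CharTwo.add_self_eq_zero _

/-- Take a null vector `x` with `x v = 1` and add 1 to the diagonal entry at `v`. By symmetry `x`
pairs to zero with the range, so any new null vector `z` has `z v = 0`. The new kernel is the
hyperplane `z v = 0` of the old one, proper because it omits `x`. -/
theorem exists_finrank_ker_succ {G : SimpleGraph V} {d : V → ZMod 2}
    (h : 0 < Module.finrank (ZMod 2) (LinearMap.ker (shiftedAdj G d))) :
    ∃ d', Module.finrank (ZMod 2) (LinearMap.ker (shiftedAdj G d')) + 1 =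
      Module.finrank (ZMod 2) (LinearMap.ker (shiftedAdj G d)) := by
  classical
  have hnt := Module.nontrivial_of_finrank_pos h
  obtain ⟨⟨x, hxk⟩, hx⟩ := exists_ne (0 : LinearMap.ker (shiftedAdj G d))
  have hx0 : x ≠ 0 := fun h0 => hx (Subtype.ext h0)
  have hxn := mem_ker_shiftedAdj.1 hxk
  obtain ⟨v, hv⟩ := Function.ne_iff.1 hx0
  have hv1 : x v = 1 := (zmod_two_cases (x v)).resolve_left hv
  have hadd : ∀ z, shiftedAdj G (d + Pi.single v 1) z = shiftedAdj G d z + Pi.single v (z v) := by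
    intro z
    funext w
    by_cases hw : w = v
    · subst hw; simp [shiftedAdj]; ring
    · simp [shiftedAdj, hw]
  have hker : LinearMap.ker (shiftedAdj G (d + Pi.single v 1)) =
      LinearMap.ker (shiftedAdj G d) ⊓ LinearMap.ker (LinearMap.proj (R := ZMod 2)
        (φ := fun _ : V => ZMod 2) v) := by
    ext z
    rw [Submodule.mem_inf, LinearMap.mem_ker, LinearMap.mem_ker, LinearMap.mem_ker, hadd]
    constructor
    · intro hz
      have h3 := hxn.sum_mul_shiftedAdj z
      have h4 : shiftedAdj G d z = Pi.single v (z v) := by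
        funext w
        exact CharTwo.add_eq_zero.1 (congrFun hz w)
      have h5 : z v = 0 := by
        rw [h4] at h3
        simpa [Pi.single_apply, hv1] using h3
      rw [h5, Pi.single_zero] at h4
      exact ⟨h4, h5⟩
    · rintro ⟨h1, h2⟩
      rw [LinearMap.proj_apply] at h2
      rw [h1, h2, Pi.single_zero, add_zero]
  refine ⟨d + Pi.single v 1, ?_⟩
  set K := LinearMap.ker (shiftedAdj G d)
  set φ : K →ₗ[ZMod 2] ZMod 2 := (LinearMap.proj (R := ZMod 2) (φ := fun _ : V => ZMod 2) v).comp
    K.subtype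
  have hsurj : LinearMap.range φ = ⊤ := by
    rw [LinearMap.range_eq_top]
    intro c
    exact ⟨c • ⟨x, hxk⟩, by simp [φ, hv1]⟩
  have hrn := LinearMap.finrank_range_add_finrank_ker φ
  rw [hsurj, finrank_top, Module.finrank_self] at hrn
  have : Module.finrank (ZMod 2) (LinearMap.ker (shiftedAdj G (d + Pi.single v 1))) =
      Module.finrank (ZMod 2) (LinearMap.ker φ) := by
    rw [hker, LinearMap.ker_comp, ← Submodule.map_comap_subtype]
    exact (Submodule.equivSubtypeMap K _).symm.finrank_eq
  omega

theorem isNull_one (G : SimpleGraph V) : IsNull G (nbrSum G 1) 1 := fun v => by simp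

theorem exists_finrank_ker_eq {G : SimpleGraph V} {d : V → ZMod 2} {k : ℕ}
    (hk : k ≤ Module.finrank (ZMod 2) (LinearMap.ker (shiftedAdj G d))) :
    ∃ d', Module.finrank (ZMod 2) (LinearMap.ker (shiftedAdj G d')) = k := by
  induction hm : Module.finrank (ZMod 2) (LinearMap.ker (shiftedAdj G d)) - k generalizing d with
  | zero => exact ⟨d, by omega⟩
  | succ m ih =>
    obtain ⟨d', hd'⟩ := exists_finrank_ker_succ (G := G) (d := d) (by omega)
    exact ih (d := d') (by omega) (by omega)

theorem exists_one_le_finrank_ker [Nonempty V] (G : SimpleGraph V) :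
    ∃ d, 1 ≤ Module.finrank (ZMod 2) (LinearMap.ker (shiftedAdj G d)) := by
  refine ⟨nbrSum G 1, ?_⟩
  rw [Nat.one_le_iff_ne_zero, ← Nat.pos_iff_ne_zero, Module.finrank_pos_iff_exists_ne_zero]
  refine ⟨⟨1, mem_ker_shiftedAdj.2 (isNull_one G)⟩, fun h => ?_⟩
  have := congrArg Subtype.val h
  exact one_ne_zero this

open Classical in
/-- The generating function of the ranks of the adjacency matrix over `ZMod 2` under all choices of
the diagonal. -/
noncomputable def rankPolynomial (G : SimpleGraph V) : ℤ[X] :=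
  ∑ d : V → ZMod 2, X ^ Module.finrank (ZMod 2) (LinearMap.range (shiftedAdj G d))

-- The coefficients count diagonals, so no cancellation occurs.
open Classical in
theorem support_rankPolynomial (G : SimpleGraph V) : (rankPolynomial G).support =
    Finset.univ.image fun d => Module.finrank (ZMod 2) (LinearMap.range (shiftedAdj G d)) := by
  ext k
  rw [mem_support_iff, rankPolynomial, finsetSum_coeff]
  simp only [coeff_X_pow, Finset.sum_boole, Finset.mem_image, Finset.mem_univ, true_and]
  rw [Nat.cast_ne_zero, Finset.card_ne_zero]
  simp [Finset.Nonempty, eq_comm]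

theorem isBinomial_rankPolynomial_iff [Nonempty V] (G : SimpleGraph V) :
    IsBinomial (rankPolynomial G) ↔ ¬ TwoNull G := by
  classical
  have hrn : ∀ d, Module.finrank (ZMod 2) (LinearMap.range (shiftedAdj G d)) +
      Module.finrank (ZMod 2) (LinearMap.ker (shiftedAdj G d)) = Fintype.card V := fun d => by
    rw [LinearMap.finrank_range_add_finrank_ker, Module.finrank_fintype_fun_eq_card]
  obtain ⟨d₁, hd₁⟩ := exists_one_le_finrank_ker G
  have mem : ∀ k ≤ Fintype.card V, (∃ d, k ≤ Module.finrank (ZMod 2)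
      (LinearMap.ker (shiftedAdj G d))) → Fintype.card V - k ∈ (rankPolynomial G).support := by
    rintro k - ⟨d, hd⟩
    obtain ⟨d', hd'⟩ := exists_finrank_ker_eq hd
    rw [support_rankPolynomial, Finset.mem_image]
    exact ⟨d', Finset.mem_univ _, by have := hrn d'; omega⟩
  have hcard := Fintype.card_pos (α := V)
  have h0 := mem 0 (by omega) ⟨d₁, by omega⟩
  have h1 := mem 1 (by omega) ⟨d₁, hd₁⟩
  rw [twoNull_iff, IsBinomial]
  constructor
  · rintro hc ⟨d, hd⟩
    have h2 := mem 2 (by have := hrn d; omega) ⟨d, hd⟩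
    have hle : 2 ≤ Fintype.card V := by have := hrn d; omega
    have : ({Fintype.card V - 0, Fintype.card V - 1, Fintype.card V - 2} : Finset ℕ).card ≤
        (rankPolynomial G).support.card := by
      refine Finset.card_le_card ?_
      simp [Finset.insert_subset_iff, -mem_support_iff, h1, h2]
      simpa [-mem_support_iff] using h0
    rw [hc, Finset.card_eq_three.2 ⟨_, _, _, by omega, by omega, by omega, rfl⟩] at this
    omega
  · intro h
    push Not at h
    have : (rankPolynomial G).support = {Fintype.card V - 0, Fintype.card V - 1} := by
      refine Finset.Subset.antisymm ?_ ?_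
      · intro k hk
        rw [support_rankPolynomial, Finset.mem_image] at hk
        obtain ⟨d, -, rfl⟩ := hk
        have := hrn d
        have := h d
        rw [Finset.mem_insert, Finset.mem_singleton]
        omega
      · simp only [Finset.insert_subset_iff, Finset.singleton_subset_iff]
        exact ⟨h0, h1⟩
    rw [this, Finset.card_pair (by omega)]

theorem rankPolynomial_congr {W : Type u} [Fintype W] {G : SimpleGraph V} {H : SimpleGraph W}
    (φ : G ≃g H) : rankPolynomial G = rankPolynomial H := by
  classical
  have hn : ∀ (x : W → ZMod 2) v, nbrSum G (x ∘ φ) v = nbrSum H x (φ v) := by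
    intro x v
    refine Fintype.sum_equiv φ.toEquiv _ _ fun u => ?_
    have : G.Adj v u ↔ H.Adj (φ v) (φ.toEquiv u) := φ.map_adj_iff.symm
    simp [this]
  have hr : ∀ d : W → ZMod 2, Module.finrank (ZMod 2) (LinearMap.range (shiftedAdj G (d ∘ φ))) =
      Module.finrank (ZMod 2) (LinearMap.range (shiftedAdj H d)) := by
    intro d
    have hc : (shiftedAdj G (d ∘ φ)) = (LinearEquiv.funCongrLeft (ZMod 2) (ZMod 2)
        φ.toEquiv).toLinearMap ∘ₗ shiftedAdj H d ∘ₗ (LinearEquiv.funCongrLeft (ZMod 2) (ZMod 2)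
        φ.toEquiv.symm).toLinearMap := by
      refine LinearMap.ext fun x => funext fun v => ?_
      have := hn (x ∘ φ.toEquiv.symm) v
      have hx : (x ∘ φ.toEquiv.symm) ∘ φ = x := by funext u; exact congrArg x (φ.symm_apply_apply u)
      rw [hx] at this
      change nbrSum G x v + d (φ v) * x v =
        nbrSum H (x ∘ φ.toEquiv.symm) (φ v) + d (φ v) * x (φ.symm (φ v))
      rw [this, φ.symm_apply_apply]
    rw [hc, LinearMap.range_comp, LinearMap.range_comp_of_range_eq_top _ (LinearEquiv.range _)]
    exact (LinearEquiv.submoduleMap _ _).symm.finrank_eq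
  refine (Fintype.sum_equiv (φ.toEquiv.arrowCongr (Equiv.refl (ZMod 2))).symm _ _ fun d => ?_).symm
  rw [← hr]
  rfl

end NullVectors

/-! ### Graphs with a diagonal of nullity two: cuts, local deletion, leaves -/

section PathGraph

/-- With the vertex degrees mod 2 as diagonal, the indicator of any union of components is null;
apply this to `S` and its complement. -/
theorem twoNull_of_cut {V : Type u} [Fintype V] {G : SimpleGraph V} {S : Set V} {a b : V}
    (ha : a ∈ S) (hb : b ∉ S) (hS : ∀ u ∈ S, ∀ w ∉ S, ¬ G.Adj u w) : TwoNull G := by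
  classical
  have key : ∀ T : Set V, (∀ u ∈ T, ∀ w ∉ T, ¬ G.Adj u w) →
      IsNull G (nbrSum G 1) (fun v => if v ∈ T then 1 else 0) := by
    intro T hT v
    by_cases hv : v ∈ T
    · simp only [hv, if_true, mul_one, nbrSum]
      refine Finset.sum_congr rfl fun u _ => ?_
      by_cases hu : u ∈ T
      · simp [hu]
      · simp [hT v hv u hu]
    · simp only [hv, if_false, mul_zero, nbrSum]
      refine Finset.sum_eq_zero fun u _ => ?_
      by_cases hu : u ∈ T
      · have h : ¬ G.Adj v u := fun h => hT u hu v hv h.symm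
        simp [h]
      · simp [hu]
  refine ⟨nbrSum G 1, _, _, ?_, ?_, ?_, key S hS,
    key Sᶜ fun u hu w hw h => hS w (not_not.1 hw) u hu h.symm⟩
  · exact fun h => one_ne_zero (α := ZMod 2) (by simpa [ha] using congrFun h a)
  · exact fun h => one_ne_zero (α := ZMod 2) (by simpa [hb] using congrFun h b)
  · exact fun h => one_ne_zero (α := ZMod 2) (by simpa [ha] using congrFun h a)

theorem preconnected_of_not_twoNull {V : Type u} [Fintype V] {G : SimpleGraph V}
    (h : ¬ TwoNull G) : G.Preconnected := by
  intro a b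
  by_contra hab
  exact h (twoNull_of_cut (S := {u | G.Reachable a u}) (SimpleGraph.Reachable.refl a) hab
    fun u hu w hw huw => hw (hu.trans huw.reachable))

/-- Local complementation at a vertex followed by the deletion of that vertex. -/
def localDelete {V : Type u} (G : SimpleGraph V) (v : V) : SimpleGraph {u // u ≠ v} where
  Adj a b := a ≠ b ∧ Xor (G.Adj a b) (G.Adj v a ∧ G.Adj v b)
  symm := ⟨fun a b h => ⟨h.1.symm, by
    rw [G.adj_comm b.1 a.1, and_comm (a := G.Adj v b.1)]; exact h.2⟩⟩
  loopless := ⟨fun _ h => h.1 rfl⟩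

theorem localDelete_adj {V : Type u} {G : SimpleGraph V} {v : V} {a b : {u // u ≠ v}} :
    (localDelete G v).Adj a b ↔ a ≠ b ∧ Xor (G.Adj a b) (G.Adj v a ∧ G.Adj v b) := Iff.rfl

/-- Eliminating a variable with diagonal entry one. -/
theorem TwoNull.of_localDelete {V : Type u} [Fintype V] [DecidableEq V] {G : SimpleGraph V} {v : V}
    (h : TwoNull (localDelete G v)) : TwoNull G := by
  classical
  obtain ⟨d, x, y, hx, hy, hxy, hnx, hny⟩ := h
  -- The entry at `v` is forced by row `v`, whose diagonal entry is 1.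
  let s : ({u // u ≠ v} → ZMod 2) → ZMod 2 := fun x =>
    ∑ u : {u // u ≠ v}, if G.Adj v u then x u else 0
  let ext : ({u // u ≠ v} → ZMod 2) → V → ZMod 2 := fun x u =>
    if hu : u ≠ v then x ⟨u, hu⟩ else s x
  have ext_v : ∀ x, ext x v = s x := fun x => by simp [ext]
  have ext_ne : ∀ x (u : {u // u ≠ v}), ext x u = x u := fun x u => by simp [ext, u.2]
  let D : V → ZMod 2 := fun u =>
    if hu : u ≠ v then d ⟨u, hu⟩ + (if G.Adj v u then 1 else 0) else 1
  have D_v : D v = 1 := by simp [D]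
  have D_ne : ∀ u : {u // u ≠ v}, D u = d u + (if G.Adj v u then 1 else 0) := fun u => by
    simp [D, u.2]
  have key : ∀ x, IsNull (localDelete G v) d x → IsNull G D (ext x) := by
    intro x hx w
    rw [nbrSum, Fintype.sum_eq_add_sum_subtype_ne _ v]
    simp only [ext_ne]
    by_cases hw : w = v
    · subst hw
      simp [D_v, ext_v, s]
    · lift w to {u // u ≠ v} using hw
      -- Eliminating `v` adds a rank-one matrix to the remaining block. Its off-diagonal part is
      -- local complementation; its diagonal part, the last summand here, is absorbed by the
      -- correction in `D`.
      have hterm : ∀ u : {u // u ≠ v}, (if G.Adj w u then x u else 0) =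
          (if (localDelete G v).Adj w u then x u else 0) +
          ((if G.Adj v w then 1 else 0) * (if G.Adj v u then x u else 0) +
          if u = w then (if G.Adj v w then x w else 0) else 0) := by
        intro u
        by_cases huw : u = w
        · subst huw
          by_cases h2 : G.Adj v u <;> simp [h2, CharTwo.add_self_eq_zero]
        · have huw' : w ≠ u := fun h => huw h.symm
          by_cases h1 : G.Adj w u <;> by_cases h2 : G.Adj v w <;> by_cases h3 : G.Adj v u <;>
            simp [localDelete_adj, h1, h2, h3, huw, huw', Xor, CharTwo.add_self_eq_zero]
      simp only [hterm, Finset.sum_add_distrib, ← Finset.mul_sum, Finset.sum_ite_eq',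
        Finset.mem_univ, if_true, ext_v, ext_ne, D_ne]
      have h4 := hx w
      rw [nbrSum] at h4
      rw [h4]
      by_cases h2 : G.Adj v w
      · simp only [h2, h2.symm, if_true, s]
        linear_combination CharTwo.add_self_eq_zero
          (∑ u : {u // u ≠ v}, if G.Adj v u then x u else 0)
      · have h2' : ¬ G.Adj w v := fun h => h2 h.symm
        simp [h2, h2']
  have inj : ∀ x y, ext x = ext y → x = y := fun x y h => funext fun u => by
    rw [← ext_ne x, h, ext_ne]
  have ext_zero : ext 0 = 0 := by funext u; simp [ext, s]
  exact ⟨D, ext x, ext y, fun h => hx (inj _ _ (h.trans ext_zero.symm)),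
    fun h => hy (inj _ _ (h.trans ext_zero.symm)), fun h => hxy (inj _ _ h), key x hnx, key y hny⟩

/-- A leaf attached to a vertex that separates the rest of the graph. -/
theorem twoNull_of_leaf_of_cut {V : Type u} [Fintype V] {G : SimpleGraph V} {u v a b : V}
    {S : Set V} (huv : G.Adj v u) (hleaf : ∀ w, G.Adj v w → w = u) (huS : u ∉ S) (hvS : v ∉ S)
    (hS : ∀ w ∈ S, ∀ w', G.Adj w w' → w' ≠ u → w' ∈ S) (ha : a ∈ S) (hb : b ∉ S) (hbu : b ≠ u)
    (hbv : b ≠ v) : TwoNull G := by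
  classical
  let ind : Set V → V → ZMod 2 := fun T w => if w ∈ T then 1 else 0
  -- Row `v` of the leaf, with diagonal 0, demands the value 0 at `u`. Row `u`, also with diagonal
  -- 0, then fixes the value at `v`. Neither row restricts `T`, so both sides of the cut give null
  -- vectors for the same `D`.
  let X : Set V → V → ZMod 2 := fun T w => if w = v then nbrSum G (ind T) u else ind T w
  let D : V → ZMod 2 := fun w => if w = v ∨ w = u then 0 else nbrSum G (ind {u, v}ᶜ) w
  have key : ∀ T : Set V, u ∉ T → v ∉ T → (∀ w ∈ T, ∀ w', G.Adj w w' → w' ≠ u → w' ∈ T) →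
      IsNull G D (X T) := by
    intro T huT hvT hT w
    by_cases hwv : w = v
    · subst hwv
      simp only [D, true_or, if_true, zero_mul, nbrSum]
      refine Finset.sum_eq_zero fun w' _ => ?_
      by_cases h : G.Adj w w'
      · have := hleaf _ h
        subst this
        simp [X, ind, huT, h.ne.symm]
      · simp [h]
    by_cases hwu : w = u
    · subst hwu
      simp only [D, or_true, if_true, zero_mul]
      have : X T = Pi.single v (nbrSum G (ind T) w) + ind T := by
        funext z
        by_cases hz : z = v
        · subst hz; simp [X, ind, hvT]
        · simp [X, hz]
      rw [this, nbrSum_add, CharTwo.add_eq_zero]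
      rw [nbrSum, Finset.sum_eq_single v (fun z _ hz => by simp [hz]) (by simp), if_pos huv.symm,
        Pi.single_eq_same]
    have hwv' : ¬ G.Adj w v := fun h => hwu (hleaf _ h.symm)
    have hXw : X T w = ind T w := by simp [X, hwv]
    rw [hXw]
    simp only [D, hwv, hwu, or_self, if_false]
    by_cases hw : w ∈ T
    · simp only [ind, hw, if_true, mul_one, nbrSum]
      refine Finset.sum_congr rfl fun z _ => ?_
      by_cases hz : G.Adj w z
      · have hzv : z ≠ v := fun h => hwv' (h ▸ hz)
        by_cases hzu : z = u
        · subst hzu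
          simp [X, ind, hzv, huT]
        · simp [X, ind, hzv, hzu, hT w hw z hz hzu]
      · simp [hz]
    · simp only [ind, hw, if_false, mul_zero, nbrSum]
      refine Finset.sum_eq_zero fun z _ => ?_
      by_cases hz : G.Adj w z
      · have hzv : z ≠ v := fun h => hwv' (h ▸ hz)
        have : z ∉ T := fun h => hw (hT z h w hz.symm hwu)
        simp [X, ind, hzv, this]
      · simp [hz]
  have hav : a ≠ v := fun h => hvS (h ▸ ha)
  refine ⟨D, X S, X (S ∪ {u, v})ᶜ, ?_, ?_, ?_, key S huS hvS hS, key _ (by simp) (by simp) ?_⟩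
  · exact fun h => one_ne_zero (α := ZMod 2) (by simpa [X, ind, ha, hav] using congrFun h a)
  · exact fun h => one_ne_zero (α := ZMod 2) (by simpa [X, ind, hb, hbu, hbv] using congrFun h b)
  · exact fun h => one_ne_zero (α := ZMod 2) (by simpa [X, ind, ha, hav] using congrFun h a)
  · simp only [Set.mem_compl_iff, Set.mem_union, Set.mem_insert_iff, Set.mem_singleton_iff, not_or]
    rintro w ⟨h1, h2, h3⟩ w' hww' hw'
    exact ⟨fun h => h1 (hS w' h w hww'.symm h2), hw', fun h => h2 (hleaf w (h ▸ hww').symm)⟩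

/-- Reversal of a path. -/
def pathGraphRev (n : ℕ) : SimpleGraph.pathGraph n ≃g SimpleGraph.pathGraph n where
  toEquiv := Fin.revPerm
  map_rel_iff' := by
    intro a b
    simp only [SimpleGraph.pathGraph_adj, Fin.revPerm_apply, Fin.val_rev]
    omega

/-- Attaching a leaf to the end of a path. -/
theorem isPathGraph_of_leaf {V : Type u} {G : SimpleGraph V} {u v : V} {n : ℕ} (huv : G.Adj v u)
    (hleaf : ∀ w, G.Adj v w → w = u) (e : localDelete G v ≃g SimpleGraph.pathGraph n)
    (he : (e ⟨u, huv.ne.symm⟩ : ℕ) = 0) : IsPathGraph G := by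
  classical
  let F : V → Fin (n + 1) := fun w => if hw : w ≠ v then (e ⟨w, hw⟩).succ else 0
  have F_v : F v = 0 := by simp [F]
  have F_ne : ∀ w : {w // w ≠ v}, F w = (e w).succ := fun w => by simp [F, w.2]
  have hinj : Function.Injective F := by
    intro a b hab
    by_cases ha : a = v <;> by_cases hb : b = v
    · rw [ha, hb]
    · lift b to {w // w ≠ v} using hb
      rw [ha, F_v, F_ne] at hab
      exact absurd hab.symm (Fin.succ_ne_zero _)
    · lift a to {w // w ≠ v} using ha
      rw [hb, F_v, F_ne] at hab
      exact absurd hab (Fin.succ_ne_zero _)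
    · lift a to {w // w ≠ v} using ha
      lift b to {w // w ≠ v} using hb
      rw [F_ne, F_ne, Fin.succ_inj] at hab
      exact congrArg Subtype.val (e.injective hab)
  have hsurj : Function.Surjective F := by
    intro k
    refine Fin.cases ⟨v, F_v⟩ (fun i => ⟨e.symm i, ?_⟩) k
    rw [F_ne, e.apply_symm_apply]
  have hv : ∀ w : {w // w ≠ v}, (SimpleGraph.pathGraph (n + 1)).Adj (F v) (F w) ↔ G.Adj v w := by
    intro w
    rw [SimpleGraph.pathGraph_adj, F_v, F_ne]
    simp only [Fin.val_zero, Fin.val_succ]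
    constructor
    · intro h
      have h0 : e w = e ⟨u, huv.ne.symm⟩ := Fin.ext (by omega)
      rw [e.injective h0]
      exact huv
    · intro h
      have h0 : w = ⟨u, huv.ne.symm⟩ := Subtype.ext (hleaf _ h)
      rw [h0]
      omega
  refine ⟨n + 1, ⟨⟨Equiv.ofBijective F ⟨hinj, hsurj⟩, ?_⟩⟩⟩
  intro a b
  change (SimpleGraph.pathGraph (n + 1)).Adj (F a) (F b) ↔ G.Adj a b
  by_cases ha : a = v <;> by_cases hb : b = v
  · simp [ha, hb]
  · lift b to {w // w ≠ v} using hb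
    rw [ha, hv]
  · lift a to {w // w ≠ v} using ha
    rw [hb, SimpleGraph.adj_comm, hv, SimpleGraph.adj_comm]
  · lift a to {w // w ≠ v} using ha
    lift b to {w // w ≠ v} using hb
    -- The leaf `v` has a single neighbour, so local complementation at `v` changes no edge.
    have h1 : (localDelete G v).Adj a b ↔ G.Adj a b := by
      rw [localDelete_adj]
      constructor
      · rintro ⟨hne, h | h⟩
        · exact h.1
        · exact absurd (Subtype.ext ((hleaf _ h.1.1).trans (hleaf _ h.1.2).symm)) hne
      · intro h
        refine ⟨fun h' => h.ne (congrArg Subtype.val h'), Or.inl ⟨h, fun h' => ?_⟩⟩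
        exact h.ne ((hleaf _ h'.1).trans (hleaf _ h'.2).symm)
    rw [← h1, ← e.map_adj_iff, F_ne, F_ne, SimpleGraph.pathGraph_adj, SimpleGraph.pathGraph_adj]
    simp

/-- Row `k` of the path expresses the entry at `k + 1` through earlier ones, so a null vector
vanishing at the end is zero. Two nonzero null vectors both take the value 1 there, hence their sum
is zero. -/
theorem not_twoNull_of_isPathGraph {V : Type u} [Fintype V] {G : SimpleGraph V}
    (h : IsPathGraph G) : ¬ TwoNull G := by
  classical
  obtain ⟨n, ⟨e⟩⟩ := h
  rintro ⟨d, x, y, hx, hy, hxy, hnx, hny⟩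
  have hn : 0 < n := by
    obtain ⟨v, -⟩ := Function.ne_iff.1 hx
    exact (e v).pos
  have key : ∀ z, IsNull G d z → z (e.symm ⟨0, hn⟩) = 0 → z = 0 := by
    intro z hz h0
    have main : ∀ k (hk : k < n), z (e.symm ⟨k, hk⟩) = 0 := by
      intro k
      induction k using Nat.strong_induction_on with
      | _ k ih =>
        intro hk
        rcases k with _ | k
        · exact h0
        · have h1 := hz (e.symm ⟨k, by omega⟩)
          rw [ih k (by omega), mul_zero, nbrSum, Finset.sum_eq_single (e.symm ⟨k + 1, hk⟩)] at h1
          · rwa [if_pos] at h1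
            rw [e.symm.map_adj_iff, SimpleGraph.pathGraph_adj]
            exact Or.inl rfl
          · intro b _ hb
            rw [ite_eq_right_iff]
            intro hadj
            rw [← e.map_adj_iff, e.apply_symm_apply, SimpleGraph.pathGraph_adj] at hadj
            simp only at hadj
            have h2 : e b ≠ ⟨k + 1, hk⟩ := fun h => hb (by rw [← h, e.symm_apply_apply])
            have h3 : (e b : ℕ) ≠ k + 1 := fun h => h2 (Fin.ext h)
            have := ih (e b) (by omega) (e b).2
            simpa using this
          · simp
    funext v
    simpa using main (e v) (e v).2
  have hx0 := (zmod_two_cases _).resolve_left fun h => hx (key x hnx h)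
  have hy0 := (zmod_two_cases _).resolve_left fun h => hy (key y hny h)
  have hadd : x + y = 0 := by
    refine key _ (fun v => ?_) ?_
    · rw [nbrSum_add, hnx, hny, Pi.add_apply, mul_add]
    · rw [Pi.add_apply, hx0, hy0]
      exact CharTwo.add_self_eq_zero _
  exact hxy (funext fun v => CharTwo.add_eq_zero.1 (congrFun hadd v))

end PathGraph

/-! ### Graphs all of whose local deletions are paths -/

section PathGraph

theorem SimpleGraph.Preconnected.exists_adj {V : Type u} {G : SimpleGraph V} (h : G.Preconnected)
    {a b : V} (hab : a ≠ b) : ∃ c, G.Adj a c := by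
  obtain ⟨p⟩ := h a b
  cases p with
  | nil => exact absurd rfl hab
  | cons hadj _ => exact ⟨_, hadj⟩

theorem IsPathGraph.not_adj_three {V : Type u} {G : SimpleGraph V} (h : IsPathGraph G)
    {a x y z : V} (hx : G.Adj a x) (hy : G.Adj a y) (hz : G.Adj a z) (hxy : x ≠ y) (hxz : x ≠ z)
    (hyz : y ≠ z) : False := by
  obtain ⟨n, ⟨e⟩⟩ := h
  rw [← e.map_adj_iff, SimpleGraph.pathGraph_adj] at hx hy hz
  have h1 : (e x : ℕ) ≠ e y := fun h => hxy (e.injective (Fin.ext h))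
  have h2 : (e x : ℕ) ≠ e z := fun h => hxz (e.injective (Fin.ext h))
  have h3 : (e y : ℕ) ≠ e z := fun h => hyz (e.injective (Fin.ext h))
  omega

theorem IsPathGraph.exists_end {V : Type u} [Nonempty V] {G : SimpleGraph V} (h : IsPathGraph G) :
    ∃ p, ∀ b c, G.Adj p b → G.Adj p c → b = c := by
  obtain ⟨n, ⟨e⟩⟩ := h
  have hn : 0 < n := (e (Classical.arbitrary V)).pos
  refine ⟨e.symm ⟨0, hn⟩, fun b c hb hc => e.injective (Fin.ext ?_)⟩
  rw [← e.map_adj_iff, e.apply_symm_apply, SimpleGraph.pathGraph_adj] at hb hc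
  simp only at hb hc
  omega

/-- If every local deletion of a connected graph is a path, then the graph has a leaf. -/
theorem exists_leaf_of_localDelete {V : Type u} {G : SimpleGraph V} [Nontrivial V]
    (hconn : G.Preconnected) (hH : ∀ v, IsPathGraph (localDelete G v))
    (hHc : ∀ v, (localDelete G v).Preconnected) :
    ∃ v u, G.Adj v u ∧ ∀ w, G.Adj v w → w = u := by
  by_contra! hleaf
  -- A vertex of degree at least three is adjacent to all others: deleting a non-neighbour `v` would
  -- keep three edges at `w`.
  have hdom : ∀ {w x y z v : V}, G.Adj w x → G.Adj w y → G.Adj w z → x ≠ y → x ≠ z → y ≠ z →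
      v ≠ w → G.Adj w v := by
    intro w x y z v hx hy hz hxy hxz hyz hvw
    by_contra hv
    have hv' : ¬ G.Adj v w := fun h => hv h.symm
    have lift : ∀ t (ht : G.Adj w t), (localDelete G v).Adj ⟨w, hvw.symm⟩
        ⟨t, fun h => hv (h ▸ ht)⟩ := by
      intro t ht
      exact ⟨fun h => ht.ne (congrArg Subtype.val h), Or.inl ⟨ht, fun h => hv' h.1⟩⟩
    exact (hH v).not_adj_three (lift x hx) (lift y hy) (lift z hz)
      (fun h => hxy (congrArg Subtype.val h)) (fun h => hxz (congrArg Subtype.val h))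
      (fun h => hyz (congrArg Subtype.val h))
  -- No vertex has degree three or more. If `w` had, it would dominate, and the rest of the graph
  -- would be the complement of a path `p0, p1, p2, …`. As `p1` is no leaf, it has a neighbour `c`
  -- beyond `p2`; then `p0` is adjacent to `w`, `p2` and `c`, so by `hdom` also to `p1`, which is
  -- false.
  have htwo : ∀ {w x y z : V}, G.Adj w x → G.Adj w y → G.Adj w z → x ≠ y → x ≠ z → y ≠ z →
      False := by
    intro w x y z hx hy hz hxy hxz hyz
    have hw : ∀ v, v ≠ w → G.Adj w v := fun v hv => hdom hx hy hz hxy hxz hyz hv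
    have hadj : ∀ a b : {v // v ≠ w}, (localDelete G w).Adj a b ↔ a ≠ b ∧ ¬ G.Adj a b := by
      intro a b
      simp [localDelete_adj, hw a a.2, hw b b.2, Xor]
    obtain ⟨n, ⟨e⟩⟩ := hH w
    have hn : 3 ≤ n := by
      have h1 : (e ⟨x, hx.ne.symm⟩ : ℕ) ≠ e ⟨y, hy.ne.symm⟩ := fun h =>
        hxy (congrArg Subtype.val (e.injective (Fin.ext h)))
      have h2 : (e ⟨x, hx.ne.symm⟩ : ℕ) ≠ e ⟨z, hz.ne.symm⟩ := fun h =>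
        hxz (congrArg Subtype.val (e.injective (Fin.ext h)))
      have h3 : (e ⟨y, hy.ne.symm⟩ : ℕ) ≠ e ⟨z, hz.ne.symm⟩ := fun h =>
        hyz (congrArg Subtype.val (e.injective (Fin.ext h)))
      omega
    obtain ⟨p, hp⟩ : ∃ p : ∀ i, i < n → {v // v ≠ w}, ∀ i hi, e (p i hi) = ⟨i, hi⟩ :=
      ⟨fun i hi => e.symm ⟨i, hi⟩, fun i hi => e.apply_symm_apply _⟩
    have hG : ∀ a b, a ≠ b → (G.Adj a.1 b.1 ↔ ¬ ((e a : ℕ) + 1 = e b ∨ (e b : ℕ) + 1 = e a)) := by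
      intro a b hab
      rw [← SimpleGraph.pathGraph_adj, e.map_adj_iff, hadj]
      simp [hab]
    have hne : ∀ {a b : {v // v ≠ w}}, (e a : ℕ) ≠ e b → a ≠ b := fun h h' => h (by rw [h'])
    set p0 := p 0 (by omega) with hp0
    set p1 := p 1 (by omega) with hp1
    set p2 := p 2 (by omega) with hp2
    have e0 : (e p0 : ℕ) = 0 := by rw [hp0, hp]
    have e1 : (e p1 : ℕ) = 1 := by rw [hp1, hp]
    have e2 : (e p2 : ℕ) = 2 := by rw [hp2, hp]
    have h01 : ¬ G.Adj p0 p1 := by rw [hG _ _ (hne (by omega))]; omega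
    have h12 : ¬ G.Adj p1 p2 := by rw [hG _ _ (hne (by omega))]; omega
    have h02 : G.Adj p0 p2 := by rw [hG _ _ (hne (by omega))]; omega
    obtain ⟨c, hc1, hcw⟩ := hleaf p1 w (hw _ p1.2).symm
    lift c to {v // v ≠ w} using hcw
    have hc : (e c : ℕ) ≠ 0 ∧ (e c : ℕ) ≠ 1 ∧ (e c : ℕ) ≠ 2 := by
      refine ⟨fun h => ?_, fun h => ?_, fun h => ?_⟩
      · rw [e.injective (Fin.ext (h.trans e0.symm) : e c = e p0)] at hc1
        exact h01 hc1.symm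
      · rw [e.injective (Fin.ext (h.trans e1.symm) : e c = e p1)] at hc1
        exact hc1.ne rfl
      · rw [e.injective (Fin.ext (h.trans e2.symm) : e c = e p2)] at hc1
        exact h12 hc1
    have h0c : G.Adj p0 c := by rw [hG _ _ (hne (by omega))]; omega
    have hsub : ∀ {a b : {v // v ≠ w}}, (e a : ℕ) ≠ e b → a.1 ≠ b.1 := fun h h' =>
      hne h (Subtype.ext h')
    exact h01 (hdom (hw _ p0.2).symm h02 h0c p2.2.symm c.2.symm (hsub (by omega))
      (hsub (by omega)))
  obtain ⟨v⟩ : Nonempty V := inferInstance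
  obtain ⟨v', hv'⟩ := exists_ne v
  have : Nonempty {u // u ≠ v} := ⟨⟨v', hv'⟩⟩
  -- Without leaves every degree is now two, as in a cycle. The end `p` of the path left by `v` then
  -- has two neighbours there, unless `v`, `p` and the other neighbour of `v` form a triangle; in
  -- that case `p` would be isolated, against `hHc`.
  obtain ⟨p, hp⟩ := (hH v).exists_end
  obtain ⟨a, ha⟩ := hconn.exists_adj p.2
  by_cases hpv : G.Adj v p
  · obtain ⟨b, hb, hbp⟩ := hleaf v p hpv
    have hpb' : p ≠ ⟨b, hb.ne.symm⟩ := fun h => hbp (congrArg Subtype.val h).symm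
    by_cases hpb : G.Adj p b
    · obtain ⟨c, hne, hc⟩ := (hHc v).exists_adj hpb'
      by_cases hcb : c.1 = b
      · rcases hc with ⟨-, h⟩ | ⟨-, h⟩
        · exact h ⟨hpv, hcb ▸ hb⟩
        · exact h (hcb ▸ hpb)
      · have hpc : p.1 ≠ c := fun h => hne (Subtype.ext h)
        rcases hc with ⟨h, -⟩ | ⟨⟨-, h⟩, -⟩
        · exact htwo hpv.symm hpb h hb.ne c.2.symm (Ne.symm hcb)
        · exact htwo hpv hb h hbp.symm hpc (Ne.symm hcb)
    · obtain ⟨c, hc, hcv⟩ := hleaf p v hpv.symm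
      have hcb : b ≠ c := fun h => hpb (h ▸ hc)
      refine hcb (congrArg Subtype.val (hp ⟨b, hb.ne.symm⟩ ⟨c, hcv⟩ ⟨hpb', Or.inr ⟨⟨hpv, hb⟩, hpb⟩⟩
        ⟨fun h => hc.ne (congrArg Subtype.val h), Or.inl ⟨hc, fun h => ?_⟩⟩))
      exact htwo hpv hb h.2 hbp.symm hc.ne hcb
  · obtain ⟨b, hb, hba⟩ := hleaf p a ha
    have lift : ∀ t (ht : G.Adj p t), (localDelete G v).Adj p ⟨t, fun h => hpv (h ▸ ht).symm⟩ :=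
      fun t ht => ⟨fun h => ht.ne (congrArg Subtype.val h), Or.inl ⟨ht, fun h => hpv h.1⟩⟩
    exact hba (congrArg Subtype.val (hp _ _ (lift b hb) (lift a ha)))

/-- Induction on the number of vertices: a leaf `v` is removed, and its neighbour is shown to be an
end of the path that remains. -/
theorem isPathGraph_of_not_twoNull {V : Type u} [Fintype V] (G : SimpleGraph V)
    (h : ¬ TwoNull G) : IsPathGraph G := by
  classical
  induction hn : Fintype.card V generalizing V with
  | zero =>
    have := Fintype.card_eq_zero_iff.1 hn
    exact ⟨0, ⟨⟨Equiv.equivOfIsEmpty _ _, fun {a} => isEmptyElim a⟩⟩⟩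
  | succ n ih =>
    have hsub : ∀ v, ¬ TwoNull (localDelete G v) := fun v hv => h hv.of_localDelete
    have hH : ∀ v, IsPathGraph (localDelete G v) := fun v =>
      ih _ (hsub v) (by rw [Fintype.card_subtype_compl, Fintype.card_subtype_eq, hn]; rfl)
    rcases Nat.eq_zero_or_pos n with rfl | hpos
    · have := Fintype.card_le_one_iff_subsingleton.1 hn.le
      refine ⟨1, ⟨⟨Fintype.equivFinOfCardEq hn, fun {a b} => ?_⟩⟩⟩
      rw [Subsingleton.elim a b]
      simp
    have : Nontrivial V := Fintype.one_lt_card_iff_nontrivial.1 (by omega)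
    obtain ⟨v, u, huv, hleaf⟩ := exists_leaf_of_localDelete (preconnected_of_not_twoNull h) hH
      fun v => preconnected_of_not_twoNull (hsub v)
    obtain ⟨m, ⟨e⟩⟩ := hH v
    set u' : {w // w ≠ v} := ⟨u, huv.ne.symm⟩ with hu'
    by_cases h0 : (e u' : ℕ) = 0
    · exact isPathGraph_of_leaf huv hleaf e h0
    by_cases h1 : (e u' : ℕ) + 1 = m
    · refine isPathGraph_of_leaf huv hleaf (e.trans (pathGraphRev m)) ?_
      change ((Fin.rev (e u') : Fin m) : ℕ) = 0
      rw [Fin.val_rev]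
      omega
    have hlt := (e u').2
    have hval : ∀ i : Fin m, e ⟨(e.symm i).1, (e.symm i).2⟩ = i := fun i => e.apply_symm_apply i
    exfalso
    -- The neighbour `u` is interior to the path. The vertices before it form one side of the cut;
    -- the first vertex and the successor of `u` witness that both sides are non-empty.
    refine h (twoNull_of_leaf_of_cut (S := {w | ∃ hw : w ≠ v, (e ⟨w, hw⟩ : ℕ) < e u'})
      (a := (e.symm ⟨0, by omega⟩).1) (b := (e.symm ⟨(e u' : ℕ) + 1, by omega⟩).1) huv hleaf
      ?_ ?_ ?_ ?_ ?_ ?_ (e.symm _).2)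
    · rintro ⟨_, h⟩
      exact lt_irrefl _ h
    · rintro ⟨h, _⟩
      exact h rfl
    · rintro w ⟨hw, hlt⟩ w' hww' hw'
      have hw'v : w' ≠ v := by
        rintro rfl
        have := hleaf w hww'.symm
        subst this
        exact lt_irrefl _ hlt
      refine ⟨hw'v, ?_⟩
      have hadj : (localDelete G v).Adj ⟨w, hw⟩ ⟨w', hw'v⟩ :=
        ⟨fun h => hww'.ne (congrArg Subtype.val h), Or.inl ⟨hww', fun h => hw' (hleaf _ h.2)⟩⟩
      rw [← e.map_adj_iff, SimpleGraph.pathGraph_adj] at hadj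
      have hne : (e ⟨w', hw'v⟩ : ℕ) ≠ e u' := fun h =>
        hw' (congrArg Subtype.val (e.injective (Fin.ext h)))
      omega
    · refine ⟨(e.symm ⟨0, by omega⟩).2, ?_⟩
      rw [hval]
      exact Nat.pos_of_ne_zero h0
    · rintro ⟨_, h⟩
      rw [hval] at h
      simp only at h
      omega
    · intro h
      have h2 : e.symm ⟨(e u' : ℕ) + 1, by omega⟩ = u' := Subtype.ext h
      rw [e.symm_apply_eq] at h2
      have := congrArg Fin.val h2
      simp only at this
      omega

end PathGraph

namespace RibbonGraph

/-! ### Tours round the vertex boundary -/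

section Travel

variable {R : RibbonGraph.{u}}

theorem across_across (x : R.Corner) : R.across (R.across x) = x := by
  simp [across]

theorem across_ne (x : R.Corner) : R.across x ≠ x := by
  intro h
  have := congrArg (fun y : R.Corner => y.2.2) h
  simp [across] at this

theorem along_along (x : R.Corner) : R.along (R.along x) = x := by
  simp [along]

theorem across_arc_travel (x : R.Corner) : R.across (R.arc (R.travel x)) = x := by
  rw [travel, R.arc_arc, across_across]

theorem travel_injective : Function.Injective R.travel := fun x y h => by
  rw [← across_arc_travel x, h, across_arc_travel]

theorem minimalPeriod_travel_pos (x : R.Corner) : 0 < Function.minimalPeriod R.travel x :=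
  Function.minimalPeriod_pos_of_mem_periodicPts (travel_injective.mem_periodicPts x)

/-- `across` conjugates `travel` to its inverse: it reverses the direction of the tour. -/
theorem travel_across_travel (x : R.Corner) : R.travel (R.across (R.travel x)) = R.across x := by
  rw [travel, across_across, travel, R.arc_arc]

/-- A tour never returns to an end in the opposite direction. Conjugation by `across` shortens such
a return by two steps, down to a fixed point of `across` or of `arc`. -/
theorem iterate_travel_ne_across (k : ℕ) (x : R.Corner) : R.travel^[k] x ≠ R.across x := by
  induction k using Nat.twoStepInduction generalizing x with
  | zero => exact (across_ne x).symm
  | one => exact R.arc_ne _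
  | more k ih _ =>
    intro h
    rw [Function.iterate_succ_apply, Function.iterate_succ_apply', ← travel_across_travel] at h
    exact ih _ (travel_injective h)

/-- Two corners that are met on the same tour and lie at the same end coincide. -/
theorem iterate_travel_eq_of_end_eq {x : R.Corner} {i j : ℕ}
    (h1 : (R.travel^[i] x).1 = (R.travel^[j] x).1)
    (h2 : (R.travel^[i] x).2.1 = (R.travel^[j] x).2.1) : R.travel^[i] x = R.travel^[j] x := by
  wlog hij : i ≤ j generalizing i j
  · exact (this h1.symm h2.symm (by omega)).symm
  obtain ⟨k, rfl⟩ := Nat.exists_eq_add_of_le' hij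
  rw [Function.iterate_add_apply] at h1 h2 ⊢
  have hne := iterate_travel_ne_across k (R.travel^[i] x)
  generalize R.travel^[i] x = y at *
  by_contra h
  refine hne (Prod.ext h1.symm (Prod.ext h2.symm ?_))
  change _ = !y.2.2
  have h3 : y.2.2 ≠ (R.travel^[k] y).2.2 := fun h3 => h (Prod.ext h1 (Prod.ext h2 h3))
  revert h3
  cases y.2.2 <;> cases (R.travel^[k] y).2.2 <;> simp

variable (R) in
/-- In a bouquet with an edge, a function that is constant along the boundary of the vertex is
constant. -/
theorem IsBouquet.eq_of_invariant (hR : R.IsBouquet) {α : Type*} (f : R.Corner → α)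
    (h1 : ∀ x, f (R.across x) = f x) (h2 : ∀ x, f (R.arc x) = f x) (x y : R.Corner) :
    f x = f y := by
  rw [IsBouquet, numVertices] at hR
  set r := fun x y : R.Corner => y = R.across x ∨ y = R.arc x
  have : Nonempty (Quot r) := ⟨Quot.mk _ x⟩
  have hpos : 0 < Nat.card (Quot r) := Nat.card_pos
  have : Subsingleton (Quot r) := (Nat.card_eq_one_iff_unique.1 (by omega)).1
  have hf : ∀ a b, r a b → f a = f b := by
    rintro a b (rfl | rfl)
    · exact (h1 a).symm
    · exact (h2 a).symm
  exact congrArg (Quot.lift f hf) (Subsingleton.elim (Quot.mk r x) (Quot.mk r y))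

/-- The corners on the tour and on its reversal are closed under `across` and `arc`, and the vertex
boundary is a single curve. -/
theorem IsBouquet.exists_iterate_travel (hR : R.IsBouquet) (x y : R.Corner) :
    (∃ i, R.travel^[i] x = y) ∨ ∃ i, R.travel^[i] x = R.across y := by
  let f : R.Corner → Prop := fun y =>
    (∃ i, R.travel^[i] x = y) ∨ ∃ i, R.travel^[i] x = R.across y
  have h2 : ∀ y, f y → f (R.arc y) := by
    rintro y (⟨i, hi⟩ | ⟨i, hi⟩)
    · right
      obtain ⟨j, hj⟩ : ∃ j, R.travel^[j + 1] x = y := by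
        rcases i with _ | i
        · refine ⟨Function.minimalPeriod R.travel x - 1, ?_⟩
          rw [Nat.sub_add_cancel (minimalPeriod_travel_pos x), Function.iterate_minimalPeriod]
          exact hi
        · exact ⟨i, hi⟩
      refine ⟨j, ?_⟩
      rw [← hj, Function.iterate_succ_apply', across_arc_travel]
    · left
      refine ⟨i + 1, ?_⟩
      rw [Function.iterate_succ_apply', hi, travel, across_across]
  have h := hR.eq_of_invariant R f (fun y => ?_)
    (fun y => propext ⟨fun h => R.arc_arc y ▸ h2 _ h, h2 y⟩) x y
  · exact h.mp (Or.inl ⟨0, rfl⟩)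
  · simp only [f, across_across]
    exact propext or_comm

/-- Each edge is met exactly twice on a tour round the vertex of a bouquet. -/
theorem IsBouquet.exists_positions (hR : R.IsBouquet) (x : R.Corner) (e : R.E) :
    ∃ p q, p < q ∧ q < Function.minimalPeriod R.travel x ∧ (R.travel^[p] x).1 = e ∧
      (R.travel^[q] x).1 = e ∧ (R.travel^[q] x).2.1 = !(R.travel^[p] x).2.1 ∧
      ∀ k < Function.minimalPeriod R.travel x, (R.travel^[k] x).1 = e → k = p ∨ k = q := by
  have hex : ∀ b, ∃ p < Function.minimalPeriod R.travel x,
      (R.travel^[p] x).1 = e ∧ (R.travel^[p] x).2.1 = b := by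
    intro b
    have h : ∃ i, (R.travel^[i] x).1 = e ∧ (R.travel^[i] x).2.1 = b := by
      rcases hR.exists_iterate_travel x (e, b, false) with ⟨i, hi⟩ | ⟨i, hi⟩
      · exact ⟨i, by simp [hi]⟩
      · exact ⟨i, by simp [hi, across]⟩
    obtain ⟨i, hi⟩ := h
    refine ⟨i % Function.minimalPeriod R.travel x, Nat.mod_lt _ (minimalPeriod_travel_pos x), ?_⟩
    rwa [Function.iterate_mod_minimalPeriod_eq]
  have huniq : ∀ i < Function.minimalPeriod R.travel x, ∀ j < Function.minimalPeriod R.travel x,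
      (R.travel^[i] x).1 = (R.travel^[j] x).1 → (R.travel^[i] x).2.1 = (R.travel^[j] x).2.1 →
      i = j := fun i hi j hj h1 h2 =>
    Function.iterate_injOn_Iio_minimalPeriod hi hj (iterate_travel_eq_of_end_eq h1 h2)
  obtain ⟨p, hp, hpe, hpb⟩ := hex false
  obtain ⟨q, hq, hqe, hqb⟩ := hex true
  have hall : ∀ k < Function.minimalPeriod R.travel x, (R.travel^[k] x).1 = e → k = p ∨ k = q := by
    intro k hk hke
    cases hkb : (R.travel^[k] x).2.1
    · exact Or.inl (huniq k hk p hp (hke.trans hpe.symm) (hkb.trans hpb.symm))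
    · exact Or.inr (huniq k hk q hq (hke.trans hqe.symm) (hkb.trans hqb.symm))
  rcases lt_trichotomy p q with h | h | h
  · exact ⟨p, q, h, hq, hpe, hqe, by rw [hpb, hqb]; rfl, hall⟩
  · subst h; simp [hpb] at hqb
  · exact ⟨q, p, h, hp, hqe, hpe, by rw [hpb, hqb]; rfl, fun k hk hke => (hall k hk hke).symm⟩

end Travel

/-! ### Potentials with prescribed jumps -/

section Potential

variable {R : RibbonGraph.{u}}

open Classical in
/-- The number of times an edge is met in the first `j` steps of a tour. -/
noncomputable def visits (R : RibbonGraph.{u}) (x : R.Corner) (j : ℕ) (f : R.E) : ℕ :=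
  {k ∈ Finset.range j | (R.travel^[k] x).1 = f}.card

theorem sum_visits (x : R.Corner) (j : ℕ) (y : R.E → ZMod 2) :
    ∑ k ∈ Finset.range j, y (R.travel^[k] x).1 = ∑ f, (R.visits x j f : ZMod 2) * y f := by
  classical
  rw [← Finset.sum_fiberwise (Finset.range j) (fun k => (R.travel^[k] x).1)]
  refine Finset.sum_congr rfl fun f _ => ?_
  rw [Finset.sum_congr rfl (g := fun _ => y f) fun k hk => by rw [(Finset.mem_filter.1 hk).2],
    Finset.sum_const, nsmul_eq_mul, visits]

/-- A function on the corners, constant along the arcs, that jumps by `y e` across the ends of an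
edge `e`. -/
structure IsPotential (R : RibbonGraph.{u}) (y : R.E → ZMod 2) (g : R.Corner → ZMod 2) : Prop where
  arc : ∀ x, g (R.arc x) = g x
  across : ∀ x, g (R.across x) = g x + y x.1

theorem IsPotential.iterate_travel {y : R.E → ZMod 2} {g : R.Corner → ZMod 2}
    (h : R.IsPotential y g) (x : R.Corner) (j : ℕ) :
    g (R.travel^[j] x) = g x + ∑ k ∈ Finset.range j, y (R.travel^[k] x).1 := by
  induction j with
  | zero => simp
  | succ j ih =>
    rw [Function.iterate_succ_apply', travel, h.arc, h.across, ih, Finset.sum_range_succ, add_assoc]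

theorem IsBouquet.visits_minimalPeriod (hR : R.IsBouquet) (x : R.Corner) (f : R.E) :
    R.visits x (Function.minimalPeriod R.travel x) f = 2 := by
  obtain ⟨p, q, hpq, hq, hp1, hq1, -, hall⟩ := hR.exists_positions x f
  rw [visits, ← Finset.card_pair hpq.ne]
  congr 1
  ext k
  simp only [Finset.mem_filter, Finset.mem_range, Finset.mem_insert, Finset.mem_singleton]
  constructor
  · exact fun h => hall k h.1 h.2
  · rintro (rfl | rfl)
    · exact ⟨hpq.trans hq, hp1⟩
    · exact ⟨hq, hq1⟩

/-- Integrate `y` along the tour. Each edge is met twice, so the total jump is zero mod 2 and the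
partial sums are well defined. -/
theorem IsBouquet.exists_isPotential (hR : R.IsBouquet) (y : R.E → ZMod 2) :
    ∃ g, R.IsPotential y g := by
  classical
  rcases isEmpty_or_nonempty R.E with hE | ⟨⟨e₀⟩⟩
  · exact ⟨fun _ => 0, fun _ => rfl, fun x => hE.elim x.1⟩
  let x : R.Corner := (e₀, false, false)
  let S : ℕ → ZMod 2 := fun j => ∑ k ∈ Finset.range j, y (R.travel^[k] x).1
  have hS1 : ∀ j, S (j + 1) = S j + y (R.travel^[j] x).1 := fun j => Finset.sum_range_succ _ _
  set N := Function.minimalPeriod R.travel x with hN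
  have hperiod : S N = 0 := by
    simp only [S, sum_visits, hN, hR.visits_minimalPeriod]
    refine Finset.sum_eq_zero fun f _ => ?_
    rw [show ((2 : ℕ) : ZMod 2) = 0 from rfl, zero_mul]
  have hadd : ∀ j, S (N + j) = S j := by
    intro j
    induction j with
    | zero => exact hperiod
    | succ j ih =>
      rw [← add_assoc, hS1, ih, hS1, add_comm N j, Function.iterate_add_apply,
        Function.iterate_minimalPeriod]
  have hmul : ∀ m j, S (N * m + j) = S j := by
    intro m
    induction m with
    | zero => intro j; simp
    | succ m ih => intro j; rw [Nat.mul_succ, add_assoc, ih, hadd]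
  have hmod : ∀ j, S j = S (j % N) := by
    intro j
    conv_lhs => rw [← Nat.div_add_mod j N]
    exact hmul _ _
  have hwd : ∀ i j, R.travel^[i] x = R.travel^[j] x → S i = S j := by
    intro i j h
    rw [hmod i, hmod j]
    congr 1
    refine Function.iterate_injOn_Iio_minimalPeriod (f := R.travel) (x := x)
      (Nat.mod_lt _ (minimalPeriod_travel_pos x)) (Nat.mod_lt _ (minimalPeriod_travel_pos x)) ?_
    simp only [hN, Function.iterate_mod_minimalPeriod_eq]
    exact h
  -- The corner where the tour enters an end gets the sum before the jump, its partner the sum after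
  -- it. The default 0 is never used, since every corner is of one of these two kinds.
  let g : R.Corner → ZMod 2 := fun z =>
    if h : ∃ i, R.travel^[i] x = z then S h.choose
    else if h : ∃ i, R.travel^[i] x = R.across z then S (h.choose + 1) else 0
  have g1 : ∀ i, g (R.travel^[i] x) = S i := by
    intro i
    have h : ∃ j, R.travel^[j] x = R.travel^[i] x := ⟨i, rfl⟩
    simp only [g, dif_pos h]
    exact hwd _ _ h.choose_spec
  have g2 : ∀ i, g (R.across (R.travel^[i] x)) = S (i + 1) := by
    intro i
    have h0 : ¬ ∃ j, R.travel^[j] x = R.across (R.travel^[i] x) := by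
      rintro ⟨j, hj⟩
      have h1 := iterate_travel_eq_of_end_eq (x := x) (i := j) (j := i) (by rw [hj]; rfl)
        (by rw [hj]; rfl)
      exact across_ne _ (hj.symm.trans h1)
    have h : ∃ j, R.travel^[j] x = R.across (R.across (R.travel^[i] x)) :=
      ⟨i, (across_across _).symm⟩
    simp only [g, dif_neg h0, dif_pos h]
    refine hwd _ _ ?_
    rw [Function.iterate_succ_apply', h.choose_spec, across_across, Function.iterate_succ_apply']
  have harc : ∀ i, g (R.arc (R.across (R.travel^[i] x))) = g (R.across (R.travel^[i] x)) := by
    intro i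
    rw [g2, ← g1, Function.iterate_succ_apply']
    rfl
  refine ⟨g, fun z => ?_, fun z => ?_⟩
  · rcases hR.exists_iterate_travel x z with ⟨i, rfl⟩ | ⟨i, hi⟩
    · obtain ⟨j, hj⟩ : ∃ j, R.travel^[j + 1] x = R.travel^[i] x := by
        rcases i with _ | i
        · refine ⟨N - 1, ?_⟩
          rw [Nat.sub_add_cancel (minimalPeriod_travel_pos x), Function.iterate_minimalPeriod]
          rfl
        · exact ⟨i, rfl⟩
      rw [← hj, Function.iterate_succ_apply', travel, R.arc_arc, harc]
    · rw [← across_across z, ← hi, harc]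
  · rcases hR.exists_iterate_travel x z with ⟨i, rfl⟩ | ⟨i, hi⟩
    · rw [g1, g2, hS1]
    · have h : z.1 = (R.travel^[i] x).1 := by rw [hi]; rfl
      rw [h, ← hi, g1, ← across_across z, ← hi, g2, hS1, add_assoc, CharTwo.add_self_eq_zero,
        add_zero]

end Potential

/-! ### Interlacement as parity of visits -/

section Interlace

variable {R : RibbonGraph.{u}}

/-- Whether an edge `f` is met an odd number of times between the two ends of `e` depends only on
`e` and `f`. -/
theorem IsBouquet.visits_eq (hR : R.IsBouquet) {e f : R.E} (hef : e ≠ f) {x x' : R.Corner}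
    {j j' : ℕ} (hx : x.1 = e) (hj : (R.travel^[j] x).1 = e) (hjb : (R.travel^[j] x).2.1 = !x.2.1)
    (hx' : x'.1 = e) (hj' : (R.travel^[j'] x').1 = e) (hjb' : (R.travel^[j'] x').2.1 = !x'.2.1) :
    (R.visits x j f : ZMod 2) = R.visits x' j' f := by
  classical
  -- This potential jumps only at `f`, so it is constant on each end of `e`. The parity sought is
  -- the difference of its values at the two ends.
  obtain ⟨g, hg⟩ := hR.exists_isPotential (Pi.single f 1)
  have hc : ∀ z : R.Corner, z.1 = e → g z = g (e, z.2.1, false) := by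
    rintro ⟨e', b, s⟩ (he : e' = e)
    rw [he]
    cases s
    · rfl
    · have := hg.across (e, b, false)
      simpa [RibbonGraph.across, hef] using this
  have key : ∀ (x : R.Corner) (j : ℕ), x.1 = e → (R.travel^[j] x).1 = e →
      (R.travel^[j] x).2.1 = !x.2.1 →
      (R.visits x j f : ZMod 2) = g (e, false, false) + g (e, true, false) := by
    intro x j hx hj hjb
    have h := hg.iterate_travel x j
    rw [sum_visits, hc _ hj, hc x hx, hjb, Finset.sum_eq_single f (fun a _ ha => by simp [ha])
      (by simp), Pi.single_eq_same, mul_one] at h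
    have h2 := CharTwo.add_self_eq_zero (g (e, x.2.1, false))
    cases hb : x.2.1 <;> rw [hb] at h h2 <;> simp only [Bool.not_false, Bool.not_true] at h
    · linear_combination -h - h2
    · linear_combination -h - h2
  rw [key x j hx hj hjb, key x' j' hx' hj' hjb']

/-- The edge `f` is met twice on the whole tour, so an odd number of visits between the ends of `e`
means one inside and one outside. By `visits_eq` the parity may be computed from any starting
corner. -/
theorem IsBouquet.interlaced_iff (hR : R.IsBouquet) {e f : R.E} (hef : e ≠ f) {x : R.Corner} {j : ℕ}
    (hx : x.1 = e) (hjN : j < Function.minimalPeriod R.travel x) (hj : (R.travel^[j] x).1 = e)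
    (hjb : (R.travel^[j] x).2.1 = !x.2.1) :
    R.Interlaced e f ↔ (R.visits x j f : ZMod 2) = 1 := by
  classical
  constructor
  · rintro ⟨-, x', i, j', k, hi, hij, hjk, hk, h0, h1, h2, h3⟩
    have hjb' : (R.travel^[j'] x').2.1 = !x'.2.1 := by
      by_contra h
      have h4 : R.travel^[0] x' = R.travel^[j'] x' := iterate_travel_eq_of_end_eq
        (h0.trans h2.symm) (by simpa [eq_comm] using h)
      have := Function.iterate_injOn_Iio_minimalPeriod (f := R.travel) (x := x')
        (minimalPeriod_travel_pos x') (show j' < _ by omega) h4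
      omega
    rw [hR.visits_eq hef hx hj hjb h0 h2 hjb']
    obtain ⟨p, q, hpq, hq, hp1, hq1, -, hall⟩ := hR.exists_positions x' f
    have hi' := hall i (by omega) h1
    have hk' := hall k hk h3
    have : R.visits x' j' f = 1 := by
      rw [visits, Finset.card_eq_one]
      refine ⟨i, ?_⟩
      ext l
      simp only [Finset.mem_filter, Finset.mem_range, Finset.mem_singleton]
      constructor
      · rintro ⟨hl, hlf⟩
        have := hall l (by omega) hlf
        omega
      · rintro rfl
        exact ⟨hij, h1⟩
    rw [this, Nat.cast_one]
  · intro h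
    obtain ⟨p, q, hpq, hq, hp1, hq1, -, hall⟩ := hR.exists_positions x f
    have hp0 : p ≠ 0 := by
      rintro rfl
      exact hef (hx.symm.trans hp1)
    have hqj : q ≠ j := by
      rintro rfl
      exact hef (hj.symm.trans hq1)
    have hpj : p < j := by
      by_contra hpj
      have : R.visits x j f = 0 := by
        rw [visits, Finset.card_eq_zero, Finset.filter_eq_empty_iff]
        intro l hl hlf
        rw [Finset.mem_range] at hl
        have := hall l (by omega) hlf
        omega
      rw [this] at h
      exact absurd h (by decide)
    have hjq : j < q := by
      by_contra hjq
      have : R.visits x j f = 2 := by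
        rw [visits, ← Finset.card_pair hpq.ne]
        congr 1
        ext l
        simp only [Finset.mem_filter, Finset.mem_range, Finset.mem_insert, Finset.mem_singleton]
        constructor
        · exact fun h => hall l (by omega) h.2
        · rintro (rfl | rfl)
          · exact ⟨hpj, hp1⟩
          · exact ⟨by omega, hq1⟩
      rw [this] at h
      exact absurd h (by decide)
    exact ⟨hef, x, p, j, q, by omega, hpj, hjq, hq, hx, hp1, hj, hq1⟩

/-- How a potential changes from one end of an edge to the other. -/
theorem IsBouquet.exists_side (hR : R.IsBouquet) : ∃ s : R.E → Bool, ∀ y g, R.IsPotential y g →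
    ∀ e, g (e, true, s e) = g (e, false, false) + y e + nbrSum R.intersectionGraph y e := by
  classical
  have hex : ∀ e : R.E, ∃ s : Bool, ∀ y g, R.IsPotential y g →
      g (e, true, s) = g (e, false, false) + y e + nbrSum R.intersectionGraph y e := by
    intro e
    set x : R.Corner := (e, false, false) with hx
    obtain ⟨p, j, hpj, hj, hp1, hj1, hb, hall⟩ := hR.exists_positions x e
    have hp0 : p = 0 := by
      have := hall 0 (by omega) rfl
      omega
    subst hp0
    have hxj : R.travel^[j] x = (e, true, (R.travel^[j] x).2.2) := Prod.ext hj1 (Prod.ext hb rfl)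
    -- `s e` labels the corner where the tour enters the second end. Up to there it has jumped once
    -- at `e` itself, at step 0, and an odd number of times at exactly the interlaced edges.
    refine ⟨(R.travel^[j] x).2.2, fun y g hg => ?_⟩
    have hself : R.visits x j e = 1 := by
      rw [visits, Finset.card_eq_one]
      refine ⟨0, ?_⟩
      ext l
      simp only [Finset.mem_filter, Finset.mem_range, Finset.mem_singleton]
      constructor
      · rintro ⟨hl, hlf⟩
        have := hall l (by omega) hlf
        omega
      · rintro rfl
        exact ⟨hpj, rfl⟩
    rw [← hxj, hg.iterate_travel, sum_visits, add_assoc]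
    congr 1
    rw [← Finset.add_sum_erase _ _ (Finset.mem_univ e), hself, Nat.cast_one, one_mul, nbrSum,
      ← Finset.add_sum_erase (a := e) _ (fun f => if R.intersectionGraph.Adj e f then y f else 0)
        (Finset.mem_univ e), if_neg (R.intersectionGraph.irrefl), zero_add]
    congr 1
    refine Finset.sum_congr rfl fun f hf => ?_
    have hef : e ≠ f := (Finset.ne_of_mem_erase hf).symm
    have hiff : R.intersectionGraph.Adj e f ↔ _ := hR.interlaced_iff hef (x := x) rfl hj hj1 hb
    rw [hiff]
    rcases zmod_two_cases (R.visits x j f : ZMod 2) with h | h <;> simp [h]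
  choose s hs using hex
  exact ⟨s, fun y g hg e => hs e y g hg⟩

end Interlace

end RibbonGraph

namespace RibbonGraph

/-! ### Boundary components as null vectors, and the Euler genus -/

section EulerGenus

variable {R : RibbonGraph.{u}}

theorem IsBouquet.isolated_eq_zero (hR : R.IsBouquet) [hE : Nonempty R.E] : R.isolated = 0 := by
  obtain ⟨e⟩ := hE
  rw [IsBouquet, numVertices] at hR
  set r := fun x y : R.Corner => y = R.across x ∨ y = R.arc x
  have : Nonempty (Quot r) := ⟨Quot.mk _ (e, false, false)⟩
  have hpos : 0 < Nat.card (Quot r) := Nat.card_pos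
  omega

theorem IsBouquet.numComponents_eq_one (hR : R.IsBouquet) [hE : Nonempty R.E] :
    R.numComponents = 1 := by
  rw [numComponents, hR.isolated_eq_zero, add_zero, Nat.card_eq_one_iff_unique]
  obtain ⟨e⟩ := hE
  refine ⟨⟨?_⟩, ⟨Quot.mk _ (e, false, false)⟩⟩
  rintro ⟨x⟩ ⟨y⟩
  refine hR.eq_of_invariant R (fun x => Quot.mk _ x) (fun x => ?_) (fun x => ?_) x y
  · exact Eq.symm (Quot.sound (Or.inl rfl))
  · exact Eq.symm (Quot.sound (Or.inr (Or.inr rfl)))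

/-- The jump across the ends of the edges, for a function on the boundary components. -/
noncomputable def boundaryJump (R : RibbonGraph.{u}) :
    (Quot (fun x y : R.Corner => y = R.along x ∨ y = R.arc x) → ZMod 2) →ₗ[ZMod 2]
      (R.E → ZMod 2) where
  toFun h e := h (Quot.mk _ (e, false, false)) + h (Quot.mk _ (e, false, true))
  map_add' h h' := by
    funext e
    simp only [Pi.add_apply]
    ring
  map_smul' c h := by
    funext e
    simp only [Pi.smul_apply, smul_eq_mul, RingHom.id_apply]
    ring

/-- The free sides identify the values at one end of an edge with those at the other, so both ends
have the same jump. -/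
theorem isPotential_boundaryJump
    (h : Quot (fun x y : R.Corner => y = R.along x ∨ y = R.arc x) → ZMod 2) :
    R.IsPotential (R.boundaryJump h) (fun x => h (Quot.mk _ x)) := by
  refine ⟨fun x => congrArg h (Eq.symm (Quot.sound (Or.inr rfl))), ?_⟩
  rintro ⟨e, b, s⟩
  have hal : ∀ s, h (Quot.mk _ (e, true, s)) = h (Quot.mk _ (e, false, xor (R.twist e) s)) :=
    fun s => congrArg h (Quot.sound (Or.inl rfl))
  change h (Quot.mk _ (e, b, !s)) = h (Quot.mk _ (e, b, s)) +
    (h (Quot.mk _ (e, false, false)) + h (Quot.mk _ (e, false, true)))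
  have aux : ∀ a b : ZMod 2, a = b + (a + b) ∧ a = b + (b + a) := by decide
  cases b
  · cases s
    · exact (aux _ _).2
    · exact (aux _ _).1
  · rw [hal, hal]
    cases R.twist e <;> cases s
    · exact (aux _ _).2
    · exact (aux _ _).1
    · exact (aux _ _).1
    · exact (aux _ _).2

/-- If the free side leads to the corner `s e`, the jump `y e` survives in the condition and the
diagonal entry is 1. If it leads to the opposite corner, a second `y e` cancels it. -/
theorem IsPotential.along_iff {y : R.E → ZMod 2} {g : R.Corner → ZMod 2} (hg : R.IsPotential y g)
    {s : R.E → Bool}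
    (hs : ∀ e, g (e, true, s e) = g (e, false, false) + y e + nbrSum R.intersectionGraph y e)
    (e : R.E) : g (e, true, R.twist e) = g (e, false, false) ↔
      nbrSum R.intersectionGraph y e = (if R.twist e = s e then 1 else 0) * y e := by
  have aux : ∀ a b c : ZMod 2, (a + b + c = a ↔ c = 1 * b) ∧ (a + b + c + b = a ↔ c = 0 * b) := by
    decide
  by_cases h : R.twist e = s e
  · rw [if_pos h, h, hs]
    exact (aux _ _ _).1
  · have h1 := hg.across (e, true, s e)
    have h2 : R.across (e, true, s e) = (e, true, R.twist e) := by
      have : (!s e) = R.twist e := by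
        revert h
        cases s e <;> cases R.twist e <;> simp
      rw [RibbonGraph.across, ← this]
    rw [h2, hs] at h1
    rw [if_neg h, h1]
    exact (aux _ _ _).2

/-- Agreement along one free side of an edge gives agreement along the other, because both ends have
the same jump. -/
theorem IsPotential.along_eq {y : R.E → ZMod 2} {g : R.Corner → ZMod 2} (hg : R.IsPotential y g)
    (h : ∀ e, g (e, true, R.twist e) = g (e, false, false)) (x : R.Corner) :
    g (R.along x) = g x := by
  have h1 : ∀ e s, g (R.along (e, false, s)) = g (e, false, s) := by
    rintro e (_ | _)
    · simpa [along] using h e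
    · have h2 := hg.across (e, true, R.twist e)
      have h3 := hg.across (e, false, false)
      simp only [RibbonGraph.across, Bool.not_false] at h2 h3
      simp only [along, Bool.not_false, Bool.xor_true]
      rw [h2, h3, h]
  obtain ⟨e, b, s⟩ := x
  cases b
  · exact h1 e s
  · have h2 := h1 e (xor (R.twist e) s)
    have h3 : R.along (e, true, s) = (e, false, xor (R.twist e) s) := rfl
    rw [← h3, along_along] at h2
    exact h2.symm

/-- Rank-nullity for `boundaryJump`: its range is the space of null vectors, and its kernel consists
of the constants, since the vertex boundary is connected. -/
theorem IsBouquet.numBoundary_eq (hR : R.IsBouquet) [hE : Nonempty R.E] {s : R.E → Bool}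
    (hs : ∀ y g, R.IsPotential y g → ∀ e,
      g (e, true, s e) = g (e, false, false) + y e + nbrSum R.intersectionGraph y e) :
    R.numBoundary = Module.finrank (ZMod 2) (LinearMap.ker
      (shiftedAdj R.intersectionGraph fun e => if R.twist e = s e then 1 else 0)) + 1 := by
  classical
  have hrange : LinearMap.range R.boundaryJump = LinearMap.ker
      (shiftedAdj R.intersectionGraph fun e => if R.twist e = s e then 1 else 0) := by
    ext y
    rw [mem_ker_shiftedAdj]
    constructor
    · rintro ⟨h, rfl⟩ e
      have hg := isPotential_boundaryJump h
      rw [← hg.along_iff (hs _ _ hg)]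
      refine congrArg h (Eq.symm (Quot.sound (Or.inl ?_)))
      simp [along]
    · intro hy
      obtain ⟨g, hg⟩ := hR.exists_isPotential y
      have hal := hg.along_eq fun e => (hg.along_iff (hs _ _ hg) e).2 (hy e)
      refine ⟨Quot.lift g ?_, ?_⟩
      · rintro a b (rfl | rfl)
        · exact (hal a).symm
        · exact (hg.arc a).symm
      · funext e
        have h1 := hg.across (e, false, false)
        change g (e, false, true) = g (e, false, false) + y e at h1
        change g (e, false, false) + g (e, false, true) = y e
        rw [h1, ← add_assoc, CharTwo.add_self_eq_zero, zero_add]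
  have hker : LinearMap.ker R.boundaryJump = Submodule.span (ZMod 2) {1} := by
    ext h
    rw [LinearMap.mem_ker, Submodule.mem_span_singleton]
    constructor
    · intro h0
      have hg := isPotential_boundaryJump h
      obtain ⟨e⟩ := hE
      refine ⟨h (Quot.mk _ (e, false, false)), ?_⟩
      funext q
      induction q using Quot.ind with
      | _ x =>
        simp only [Pi.smul_apply, Pi.one_apply, smul_eq_mul, mul_one]
        refine hR.eq_of_invariant R (fun x => h (Quot.mk _ x)) (fun x => ?_) hg.arc _ x
        have := hg.across x
        rwa [h0, Pi.zero_apply, add_zero] at this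
    · rintro ⟨c, rfl⟩
      funext e
      exact CharTwo.add_self_eq_zero _
  have hrn := LinearMap.finrank_range_add_finrank_ker R.boundaryJump
  have hne : (1 : Quot (fun x y : R.Corner => y = R.along x ∨ y = R.arc x) → ZMod 2) ≠ 0 := by
    obtain ⟨e⟩ := hE
    exact fun h => one_ne_zero (congrFun h (Quot.mk _ (e, false, false)))
  have := Fintype.ofFinite (Quot (fun x y : R.Corner => y = R.along x ∨ y = R.arc x))
  rw [hrange, hker, finrank_span_singleton hne, Module.finrank_fintype_fun_eq_card,
    ← Nat.card_eq_fintype_card] at hrn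
  rw [numBoundary, hR.isolated_eq_zero, add_zero, hrn]

theorem IsBouquet.eulerGenus_eq (hR : R.IsBouquet) [Nonempty R.E] {s : R.E → Bool}
    (hs : ∀ y g, R.IsPotential y g → ∀ e,
      g (e, true, s e) = g (e, false, false) + y e + nbrSum R.intersectionGraph y e) :
    R.eulerGenus = Module.finrank (ZMod 2) (LinearMap.range
      (shiftedAdj R.intersectionGraph fun e => if R.twist e = s e then 1 else 0)) := by
  have hrn := LinearMap.finrank_range_add_finrank_ker
    (shiftedAdj R.intersectionGraph fun e => if R.twist e = s e then 1 else 0)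
  rw [Module.finrank_fintype_fun_eq_card] at hrn
  rw [eulerGenus, eulerChar, hR.numComponents_eq_one, hR.numBoundary_eq hs, numEdges, ← hrn,
    show R.numVertices = 1 from hR]
  push_cast
  ring

/-- The partial Petrial polynomial of a bouquet counts diagonals by the rank of the adjacency matrix
of the intersection graph over `ZMod 2`. -/
theorem IsBouquet.petrialPolynomial_eq (hR : R.IsBouquet) [Nonempty R.E] :
    R.petrialPolynomial = rankPolynomial R.intersectionGraph := by
  classical
  obtain ⟨s, hs⟩ := hR.exists_side
  let τ : Finset R.E → R.E → Bool := fun A => (R.partialPetrial A).twist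
  have τ_mem : ∀ {A : Finset R.E} {e : R.E}, e ∈ A → τ A e = !(R.twist e) := fun h => if_pos h
  have τ_not_mem : ∀ {A : Finset R.E} {e : R.E}, e ∉ A → τ A e = R.twist e := fun h => if_neg h
  have hgenus : ∀ A : Finset R.E, (R.partialPetrial A).eulerGenus =
      Module.finrank (ZMod 2) (LinearMap.range (shiftedAdj R.intersectionGraph
        fun e => if τ A e = s e then 1 else 0)) := by
    intro A
    have : Nonempty (R.partialPetrial A).E := ‹Nonempty R.E›
    -- The vertex boundary, the potentials, the interlacement and `s` do not involve `twist`, so one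
    -- `s` serves all partial Petrials.
    exact IsBouquet.eulerGenus_eq (R := R.partialPetrial A) hR (s := s)
      fun y g hg => hs y g ⟨hg.arc, hg.across⟩
  refine Fintype.sum_bijective
    (fun (A : Finset R.E) e => if τ A e = s e then (1 : ZMod 2) else 0) ⟨?_, ?_⟩ _ _
    fun A => by rw [hgenus, Int.toNat_natCast]
  · intro A B h
    ext e
    have h1 : τ A e = s e ↔ τ B e = s e := by
      have h2 := congrFun h e
      by_cases hA : τ A e = s e <;> by_cases hB : τ B e = s e <;> simp_all
    by_cases hA : e ∈ A <;> by_cases hB : e ∈ B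
    · simp [hA, hB]
    · rw [τ_mem hA, τ_not_mem hB] at h1
      revert h1
      cases R.twist e <;> cases s e <;> simp
    · rw [τ_not_mem hA, τ_mem hB] at h1
      revert h1
      cases R.twist e <;> cases s e <;> simp
    · simp [hA, hB]
  · intro d
    -- Half-twist exactly the edges whose present diagonal entry differs from `d e`.
    refine ⟨Finset.univ.filter fun e => ¬ (R.twist e = s e ↔ d e = 1), ?_⟩
    funext e
    by_cases he : R.twist e = s e ↔ d e = 1
    · simp only [τ_not_mem (A := Finset.univ.filter fun e => ¬ (R.twist e = s e ↔ d e = 1))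
        (e := e) (by simpa using he), he]
      rcases zmod_two_cases (d e) with h | h <;> simp [h]
    · simp only [τ_mem (A := Finset.univ.filter fun e => ¬ (R.twist e = s e ↔ d e = 1))
        (e := e) (by simpa using he)]
      revert he
      rcases zmod_two_cases (d e) with h | h <;> cases R.twist e <;> cases s e <;> simp [h]

end EulerGenus

end RibbonGraph

/-- For a connected circle graph, the partial Petrial polynomial does not depend on the bouquet that
represents the graph, and it is binomial if and only if the graph is a path. -/
theorem theorem2 {V : Type u} [Fintype V] (G : SimpleGraph V) (hconn : G.Connected)
    (hG : IsCircleGraph G) :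
    (∀ B : RibbonGraph.{u}, B.IsBouquet → Nonempty (B.intersectionGraph ≃g G) →
      B.petrialPolynomial = circleGraphPetrialPolynomial G hG) ∧
    (IsBinomial (circleGraphPetrialPolynomial G hG) ↔ IsPathGraph G) := by
  obtain ⟨v⟩ := hconn.nonempty
  have key : ∀ B : RibbonGraph.{u}, B.IsBouquet → Nonempty (B.intersectionGraph ≃g G) →
      B.petrialPolynomial = rankPolynomial G := by
    rintro B hB ⟨φ⟩
    have : Nonempty B.E := ⟨φ.symm v⟩
    rw [hB.petrialPolynomial_eq, rankPolynomial_congr φ]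
  have hP : circleGraphPetrialPolynomial G hG = rankPolynomial G :=
    key _ hG.choose_spec.1 hG.choose_spec.2
  have : Nonempty V := ⟨v⟩
  rw [hP, isBinomial_rankPolynomial_iff]
  exact ⟨key, isPathGraph_of_not_twoNull G, not_twoNull_of_isPathGraph⟩
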